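/- Let $p$ be an odd prime and let $n\ge 3$ be an integer. Then there is an ultraspecial $p$-group $G$ of order $p^{3n}$ that has a maximal abelian subgroup $A$ of order $p^{n+2}$; moreover $G'\le A$ and $|A:G'|=p^2$. Here a finite $p$-group is *extraspecial* if its center has order $p$ and the quotient by its center is a nontrivial elementary abelian $p$-group. A nontrivial finite $p$-group $G$ is *semi-extraspecial* if $G/N$ is extraspecial for every maximal subgroup $N$ of the center $Z(G)$. A semi-extraspecial $p$-group $G$ is *ultraspecial* if there is a positive integer $m$ with $|G:Z(G)|=p^{2m}$ and $|Z(G)|=p^{m}$. $G'$ denotes the commutator subgroup of $G$. A *maximal abelian subgroup* of $G$ is one that is maximal under inclusion among the abelian subgroups of $G$. -/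

import Mathlib

/-- A finite `p`-group is extraspecial if its center has order `p` and the quotient by the center
is a nontrivial elementary abelian `p`-group. -/
structure IsExtraspecial (p : ℕ) (G : Type*) [Group G] : Prop where
  finite : Finite G
  isPGroup : IsPGroup p G
  card_center : Nat.card (Subgroup.center G) = p
  nontrivial_quotient : Nontrivial (G ⧸ Subgroup.center G)
  quotient_comm : ∀ x y : G ⧸ Subgroup.center G, x * y = y * x
  quotient_pow : ∀ x : G ⧸ Subgroup.center G, x ^ p = 1

/-- A nontrivial finite `p`-group is semi-extraspecial if `G ⧸ N` is extraspecial for every maximal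
subgroup `N` of the center (`N ⋖ Z(G)` in the lattice of subgroups of `G`). Every subgroup of the
center is normal, so the instance argument excludes no `N`. -/
structure IsSemiExtraspecial (p : ℕ) (G : Type*) [Group G] : Prop where
  finite : Finite G
  nontrivial : Nontrivial G
  isPGroup : IsPGroup p G
  extraspecial_quotient : ∀ (N : Subgroup G) [N.Normal],
    N ⋖ Subgroup.center G → IsExtraspecial p (G ⧸ N)

/-- A semi-extraspecial `p`-group is ultraspecial if `|G : Z(G)| = p ^ (2 * n)` and
`|Z(G)| = p ^ n` for some positive integer `n`. -/
structure IsUltraspecial (p : ℕ) (G : Type*) [Group G] : Prop where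
  isSemiExtraspecial : IsSemiExtraspecial p G
  exists_params : ∃ n : ℕ, 0 < n ∧
    (Subgroup.center G).index = p ^ (2 * n) ∧ Nat.card (Subgroup.center G) = p ^ n

/-- `A` is maximal, with respect to inclusion, among the abelian subgroups of `G`. -/
def IsMaximalAbelian {G : Type*} [Group G] (A : Subgroup G) : Prop :=
  Maximal (fun B : Subgroup G => ∀ x ∈ B, ∀ y ∈ B, x * y = y * x) A

/-! Take `F` of order `p ^ n`. In the Heisenberg group of `F` the elements `(0, b, z)` form an
abelian subgroup of order `p ^ (2 * n)`; twisting the cocycle by `ψ` spoils this without affecting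
ultraspeciality. Indeed, for every `ψ`, the commutators of a fixed noncentral element fill the whole
center (`mem_center_of_forall_commutatorElement_mem`), so proper quotients of the center create no
new central elements. Now let `ψ x y = f x • π y`, with `f` a functional and `π` an endomorphism
with two-dimensional kernel `S`. The elements `(0, b, z)` with `b ∈ S` commute, and two vectors of
`S` suffice to show that nothing more commutes with them (`isMaximalAbelian_sndSubgroup`). -/

/-- The group on `F × F × F` which is the central extension of `F × F` by `F` given by the
cocycle `(a, b), (a', b') ↦ a * b' + ψ b b'`. For `ψ = 0` it is the Heisenberg group of `F`. -/
@[ext]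
structure TwistedHeisenberg {F : Type*} [Field F] (ψ : F →+ F →+ F) where
  fst : F
  snd : F
  ctr : F

namespace TwistedHeisenberg

variable {F : Type*} [Field F] {ψ : F →+ F →+ F}

instance : Mul (TwistedHeisenberg ψ) :=
  ⟨fun g h => ⟨g.fst + h.fst, g.snd + h.snd, g.ctr + h.ctr + g.fst * h.snd + ψ g.snd h.snd⟩⟩

instance : One (TwistedHeisenberg ψ) := ⟨⟨0, 0, 0⟩⟩

instance : Inv (TwistedHeisenberg ψ) :=
  ⟨fun g => ⟨-g.fst, -g.snd, -g.ctr + g.fst * g.snd + ψ g.snd g.snd⟩⟩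

@[simp] lemma fst_mul (g h : TwistedHeisenberg ψ) : (g * h).fst = g.fst + h.fst := rfl
@[simp] lemma snd_mul (g h : TwistedHeisenberg ψ) : (g * h).snd = g.snd + h.snd := rfl
@[simp] lemma ctr_mul (g h : TwistedHeisenberg ψ) :
    (g * h).ctr = g.ctr + h.ctr + g.fst * h.snd + ψ g.snd h.snd := rfl
@[simp] lemma fst_one : (1 : TwistedHeisenberg ψ).fst = 0 := rfl
@[simp] lemma snd_one : (1 : TwistedHeisenberg ψ).snd = 0 := rfl
@[simp] lemma ctr_one : (1 : TwistedHeisenberg ψ).ctr = 0 := rfl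
@[simp] lemma fst_inv (g : TwistedHeisenberg ψ) : g⁻¹.fst = -g.fst := rfl
@[simp] lemma snd_inv (g : TwistedHeisenberg ψ) : g⁻¹.snd = -g.snd := rfl
@[simp] lemma ctr_inv (g : TwistedHeisenberg ψ) :
    g⁻¹.ctr = -g.ctr + g.fst * g.snd + ψ g.snd g.snd := rfl

instance : Group (TwistedHeisenberg ψ) :=
  Group.ofLeftAxioms
    (fun g h k => by
      ext
      · simp [add_assoc]
      · simp [add_assoc]
      · simp only [ctr_mul, fst_mul, snd_mul, map_add, AddMonoidHom.add_apply]
        ring)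
    (fun g => by ext <;> simp)
    (fun g => by ext <;> simp; ring)

/-! ### Commutators and the center -/

lemma commute_iff (g h : TwistedHeisenberg ψ) :
    g * h = h * g ↔ g.fst * h.snd + ψ g.snd h.snd = h.fst * g.snd + ψ h.snd g.snd := by
  rw [TwistedHeisenberg.ext_iff]
  simp only [fst_mul, snd_mul, ctr_mul, add_comm g.fst, add_comm g.snd, true_and]
  constructor <;> intro H <;> linear_combination H

open scoped commutatorElement in
lemma commutatorElement_eq (g h : TwistedHeisenberg ψ) :
    ⁅g, h⁆ = ⟨0, 0, g.fst * h.snd + ψ g.snd h.snd - h.fst * g.snd - ψ h.snd g.snd⟩ := by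
  rw [commutatorElement_def, mul_inv_eq_iff_eq_mul, mul_inv_eq_iff_eq_mul]
  ext <;> simp <;> ring

lemma mem_center_iff (g : TwistedHeisenberg ψ) :
    g ∈ Subgroup.center (TwistedHeisenberg ψ) ↔ g.fst = 0 ∧ g.snd = 0 := by
  rw [Subgroup.mem_center_iff]
  constructor
  · intro H
    have h₁ := (commute_iff _ _).1 (H ⟨1, 0, 0⟩)
    have h₂ := (commute_iff _ _).1 (H ⟨0, 1, 0⟩)
    have hs : g.snd = 0 := by simpa using h₁
    exact ⟨by simpa [hs] using h₂.symm, hs⟩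
  · rintro ⟨h₁, h₂⟩ h
    rw [commute_iff]
    simp [h₁, h₂]

/-- The underlying set of a twisted Heisenberg group is `F × F × F`. -/
def equivProd (ψ : F →+ F →+ F) : TwistedHeisenberg ψ ≃ F × F × F where
  toFun g := (g.fst, g.snd, g.ctr)
  invFun t := ⟨t.1, t.2.1, t.2.2⟩

instance [Finite F] : Finite (TwistedHeisenberg ψ) := Finite.of_equiv _ (equivProd ψ).symm

lemma card_eq : Nat.card (TwistedHeisenberg ψ) = Nat.card F ^ 3 := by
  rw [Nat.card_congr (equivProd ψ), Nat.card_prod, Nat.card_prod]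
  ring

lemma card_center : Nat.card (Subgroup.center (TwistedHeisenberg ψ)) = Nat.card F :=
  Nat.card_congr
    { toFun := fun g => g.1.ctr
      invFun := fun z => ⟨⟨0, 0, z⟩, by simp [mem_center_iff]⟩
      left_inv := fun ⟨g, hg⟩ => by
        rw [mem_center_iff] at hg
        ext <;> simp [hg.1, hg.2]
      right_inv := fun _ => rfl }

lemma commutator_eq_center :
    commutator (TwistedHeisenberg ψ) = Subgroup.center (TwistedHeisenberg ψ) := by
  apply le_antisymm
  · rw [commutator_def, Subgroup.commutator_le]
    intro g _ h _
    simp [commutatorElement_eq, mem_center_iff]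
  · intro g hg
    rw [mem_center_iff] at hg
    -- Every central `(0, 0, z)` is a single commutator, of `(z, 0, 0)` and `(0, 1, 0)`; `ψ`
    -- contributes nothing because the first factor has zero second coordinate.
    have H := Subgroup.commutator_mem_commutator
      (Subgroup.mem_top (⟨g.ctr, 0, 0⟩ : TwistedHeisenberg ψ))
      (Subgroup.mem_top (⟨0, 1, 0⟩ : TwistedHeisenberg ψ))
    rw [commutatorElement_eq] at H
    rw [commutator_def]
    convert H using 1
    ext <;> simp [hg.1, hg.2]

lemma fst_pow (g : TwistedHeisenberg ψ) (k : ℕ) : (g ^ k).fst = k * g.fst := by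
  induction k with
  | zero => simp
  | succ k ih => rw [pow_succ, fst_mul, ih]; push_cast; ring

lemma snd_pow (g : TwistedHeisenberg ψ) (k : ℕ) : (g ^ k).snd = k * g.snd := by
  induction k with
  | zero => simp
  | succ k ih => rw [pow_succ, snd_mul, ih]; push_cast; ring

lemma pow_char_mem_center (p : ℕ) [CharP F p] (g : TwistedHeisenberg ψ) :
    g ^ p ∈ Subgroup.center (TwistedHeisenberg ψ) := by
  simp [mem_center_iff, fst_pow, snd_pow]

/-- An element that commutes with every other modulo a proper subgroup of the center is central. -/
lemma mem_center_of_forall_commutatorElement_mem {N : Subgroup (TwistedHeisenberg ψ)}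
    (hN : ¬ Subgroup.center (TwistedHeisenberg ψ) ≤ N) {g : TwistedHeisenberg ψ}
    (hg : ∀ h, g * h * g⁻¹ * h⁻¹ ∈ N) : g ∈ Subgroup.center (TwistedHeisenberg ψ) := by
  simp only [← commutatorElement_def, commutatorElement_eq] at hg
  rw [mem_center_iff]
  have hs : g.snd = 0 := by
    by_contra hs
    refine hN fun k hk => ?_
    rw [mem_center_iff] at hk
    -- The commutator of `g` with `(a, 0, 0)` is `(0, 0, -a * g.snd)`, free of `ψ`.
    convert hg ⟨-k.ctr / g.snd, 0, 0⟩ using 1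
    ext <;> simp [hk.1, hk.2, hs]
  refine ⟨?_, hs⟩
  by_contra hf
  refine hN fun k hk => ?_
  rw [mem_center_iff] at hk
  -- Since `g.snd = 0`, the `ψ` terms vanish and the commutator with `(0, b, 0)` is `(0, 0, g.fst *
  -- b)`.
  convert hg ⟨0, k.ctr / g.fst, 0⟩ using 1
  ext
  · simp [hk.1]
  · simp [hk.2]
  · simp [hs, mul_div_cancel₀ _ hf]

end TwistedHeisenberg

/-! ### Relative indices in `p`-groups -/

lemma Subgroup.card_mul_relIndex {G : Type*} [Group G] {N K : Subgroup G} (h : N ≤ K) :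
    Nat.card N * N.relIndex K = Nat.card K := by
  rw [← Subgroup.relIndex_bot_left, ← Subgroup.relIndex_bot_left]
  exact Subgroup.relIndex_mul_relIndex _ _ _ bot_le h

/-- A subgroup of a finite `p`-group covered by `K` has relative index `p` in `K`. -/
lemma IsPGroup.relIndex_eq_of_covBy {p : ℕ} [Fact p.Prime] {G : Type*} [Group G] [Finite G]
    (hG : IsPGroup p G) {N K : Subgroup G} (h : N ⋖ K) : N.relIndex K = p := by
  obtain ⟨a, ha⟩ := IsPGroup.iff_card.1 (hG.to_subgroup N)
  obtain ⟨b, hb⟩ := IsPGroup.iff_card.1 (hG.to_subgroup K)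
  have hp : 1 < p := (Fact.out : p.Prime).one_lt
  have hab : a < b := by
    rw [← Nat.pow_lt_pow_iff_right hp, ← ha, ← hb]
    exact Set.Finite.card_lt_card (Set.toFinite _) h.lt
  have hN : Nat.card (N.subgroupOf K) = p ^ a := by
    rw [← ha]
    exact Nat.card_congr (Subgroup.subgroupOfEquivOfLe h.le).toEquiv
  -- Sylow theory gives a subgroup of order `p ^ (a + 1)` between `N` and `K`; covering forces it to
  -- be `K`.
  obtain ⟨L, hL, hNL⟩ := Sylow.exists_subgroup_card_pow_succ (p := p) (n := a)
    (by rw [hb]; exact pow_dvd_pow p hab) hN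
  have hL' : Nat.card (L.map K.subtype) = p ^ (a + 1) := by
    rw [Subgroup.card_map_of_injective K.subtype_injective, hL]
  have hle : N ≤ L.map K.subtype := by
    intro x hx
    exact ⟨⟨x, h.le hx⟩, hNL (Subgroup.mem_subgroupOf.2 hx), rfl⟩
  have hK : L.map K.subtype = K := by
    refine (h.eq_or_eq hle (Subgroup.map_subtype_le L)).resolve_left fun H => ?_
    rw [H, ha] at hL'
    exact absurd (Nat.pow_right_injective hp hL') (by omega)
  rw [hK] at hL'
  have H := Subgroup.card_mul_relIndex h.le
  rw [ha, hL', pow_succ] at H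
  exact Nat.eq_of_mul_eq_mul_left (pow_pos (by omega) a) H

/-! ### Ultraspeciality for every twist -/

namespace TwistedHeisenberg

variable {F : Type*} [Field F] {ψ : F →+ F →+ F}

lemma isPGroup {p n : ℕ} [Fact p.Prime] (hF : Nat.card F = p ^ n) :
    IsPGroup p (TwistedHeisenberg ψ) :=
  IsPGroup.of_card (n := n * 3) (by rw [card_eq, hF, pow_mul])

/-- An element central modulo `N` has all its commutators in `N`, a proper subgroup of the center,
so it was already central. -/
lemma center_quotient {N : Subgroup (TwistedHeisenberg ψ)} [N.Normal]
    (hN : N ⋖ Subgroup.center (TwistedHeisenberg ψ)) :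
    Subgroup.center (TwistedHeisenberg ψ ⧸ N) =
      (Subgroup.center (TwistedHeisenberg ψ)).map (QuotientGroup.mk' N) := by
  apply le_antisymm
  · intro x hx
    obtain ⟨g, rfl⟩ := QuotientGroup.mk'_surjective N x
    refine Subgroup.mem_map_of_mem _ (mem_center_of_forall_commutatorElement_mem hN.lt.not_ge ?_)
    intro h
    have H := Subgroup.mem_center_iff.1 hx (QuotientGroup.mk' N h)
    rw [← QuotientGroup.ker_mk' N, MonoidHom.mem_ker]
    simp only [map_mul, map_inv]
    rw [← H]
    group
  · rintro _ ⟨g, hg, rfl⟩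
    rw [Subgroup.mem_center_iff]
    intro x
    obtain ⟨h, rfl⟩ := QuotientGroup.mk'_surjective N x
    rw [← map_mul, ← map_mul, Subgroup.mem_center_iff.1 hg h]

lemma isExtraspecial_quotient {p n : ℕ} [Fact p.Prime] [CharP F p] [Finite F]
    (hF : Nat.card F = p ^ n) (N : Subgroup (TwistedHeisenberg ψ)) [N.Normal]
    (hN : N ⋖ Subgroup.center (TwistedHeisenberg ψ)) :
    IsExtraspecial p (TwistedHeisenberg ψ ⧸ N) where
  finite := inferInstance
  isPGroup := (isPGroup hF).to_quotient N
  card_center := by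
    rw [center_quotient hN, ← Subgroup.relIndex_ker, QuotientGroup.ker_mk']
    exact (isPGroup hF).relIndex_eq_of_covBy hN
  nontrivial_quotient := by
    refine ⟨1, QuotientGroup.mk (QuotientGroup.mk ⟨1, 0, 0⟩), fun H => ?_⟩
    have H' := (QuotientGroup.eq_one_iff _).1 H.symm
    rw [center_quotient hN] at H'
    obtain ⟨g, hg, hgx⟩ := H'
    have := hN.le (QuotientGroup.eq.1 hgx)
    rw [mem_center_iff] at this
    have hg' := (mem_center_iff g).1 hg
    simp [hg'.1] at this
  quotient_comm := by
    intro x y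
    induction x using QuotientGroup.induction_on with | _ x
    induction y using QuotientGroup.induction_on with | _ y
    induction x using QuotientGroup.induction_on with | _ x
    induction y using QuotientGroup.induction_on with | _ y
    refine QuotientGroup.eq.2 ?_
    rw [center_quotient hN]
    refine ⟨(x * y)⁻¹ * (y * x), ?_, rfl⟩
    simp only [SetLike.mem_coe, mem_center_iff, fst_mul, snd_mul, fst_inv, snd_inv]
    constructor <;> ring
  quotient_pow := by
    intro x
    induction x using QuotientGroup.induction_on with | _ x
    induction x using QuotientGroup.induction_on with | _ x
    refine (QuotientGroup.eq_one_iff _).2 ?_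
    rw [center_quotient hN]
    exact ⟨x ^ p, pow_char_mem_center p x, rfl⟩

lemma isUltraspecial {p n : ℕ} [Fact p.Prime] [CharP F p] [Finite F] (hn : 0 < n)
    (hF : Nat.card F = p ^ n) : IsUltraspecial p (TwistedHeisenberg ψ) where
  isSemiExtraspecial :=
    { finite := inferInstance
      nontrivial := ⟨1, ⟨1, 0, 0⟩, fun H => by simpa using congrArg fst H⟩
      isPGroup := isPGroup hF
      extraspecial_quotient := fun N _ hN => isExtraspecial_quotient hF N hN }
  exists_params := by
    refine ⟨n, hn, ?_, by rw [card_center, hF]⟩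
    have H := (Subgroup.center (TwistedHeisenberg ψ)).card_mul_index
    rw [card_center, card_eq, hF, pow_succ', ← pow_mul, mul_comm n] at H
    exact Nat.eq_of_mul_eq_mul_left (pow_pos (Fact.out : p.Prime).pos n) H

/-! ### The abelian subgroups with vanishing first coordinate -/

variable (ψ) in
/-- The subgroup of the elements `(0, b, z)` with `b ∈ S`. -/
def sndSubgroup (S : AddSubgroup F) : Subgroup (TwistedHeisenberg ψ) where
  carrier := {g | g.fst = 0 ∧ g.snd ∈ S}
  mul_mem' := fun {g h} hg hh => ⟨by simp [hg.1, hh.1], S.add_mem hg.2 hh.2⟩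
  one_mem' := ⟨rfl, S.zero_mem⟩
  inv_mem' := fun {g} hg => ⟨by simp [hg.1], S.neg_mem hg.2⟩

lemma mem_sndSubgroup {S : AddSubgroup F} {g : TwistedHeisenberg ψ} :
    g ∈ sndSubgroup ψ S ↔ g.fst = 0 ∧ g.snd ∈ S := Iff.rfl

lemma card_sndSubgroup (S : AddSubgroup F) :
    Nat.card (sndSubgroup ψ S) = Nat.card S * Nat.card F := by
  rw [← Nat.card_prod]
  exact Nat.card_congr
    { toFun := fun g => (⟨g.1.snd, g.2.2⟩, g.1.ctr)
      invFun := fun t => ⟨⟨0, t.1, t.2⟩, rfl, t.1.2⟩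
      left_inv := fun ⟨g, hg⟩ => by ext <;> simp [hg.1]
      right_inv := fun _ => rfl }

lemma center_le_sndSubgroup (S : AddSubgroup F) :
    Subgroup.center (TwistedHeisenberg ψ) ≤ sndSubgroup ψ S := by
  intro g hg
  rw [mem_center_iff] at hg
  exact ⟨hg.1, hg.2 ▸ S.zero_mem⟩

/-- If `ψ` is symmetric on `S`, and `S` contains `u` and `v ≠ 0` such that `v` is in the radical
of the alternation of `ψ` and only `S` is orthogonal to `u`, then `S` defines a maximal abelian
subgroup. -/
lemma isMaximalAbelian_sndSubgroup {S : AddSubgroup F} (hS : ∀ x ∈ S, ∀ y ∈ S, ψ x y = ψ y x)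
    {u v : F} (hu : u ∈ S) (hv : v ∈ S) (hv₀ : v ≠ 0) (hvψ : ∀ y, ψ v y = ψ y v)
    (huψ : ∀ y, ψ u y = ψ y u → y ∈ S) : IsMaximalAbelian (sndSubgroup ψ S) := by
  constructor
  · intro x hx y hy
    rw [commute_iff, hx.1, hy.1, hS _ hx.2 _ hy.2]
    ring
  · intro B hB hle g hg
    -- Commuting with `(0, v, 0)` forces `g.fst * v = 0`, since the `ψ` terms cancel; commuting with
    -- `(0, u, 0)` then puts `g.snd` in `S`.
    have h₁ := (commute_iff _ _).1 (hB _ (hle (show ⟨0, v, 0⟩ ∈ sndSubgroup ψ S from ⟨rfl, hv⟩)) _ hg)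
    have h₂ := (commute_iff _ _).1 (hB _ (hle (show ⟨0, u, 0⟩ ∈ sndSubgroup ψ S from ⟨rfl, hu⟩)) _ hg)
    have hf : g.fst = 0 := by simpa [hvψ, hv₀] using h₁
    exact ⟨hf, huψ _ (by simpa [hf] using h₂)⟩

end TwistedHeisenberg

/-! ### Choice of the twist -/

/-- Data on a vector space of dimension at least two: a plane which is the kernel of an
endomorphism, together with a functional that separates a basis of the plane. -/
lemma exists_endomorphism_ker_finrank_two {K V : Type*} [Field K] [AddCommGroup V] [Module K V]
    [FiniteDimensional K V] (h : 2 ≤ Module.finrank K V) :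
    ∃ (f : V →ₗ[K] K) (π : V →ₗ[K] V) (u v : V), Module.finrank K (LinearMap.ker π) = 2 ∧
      π u = 0 ∧ π v = 0 ∧ f u = 1 ∧ f v = 0 ∧ v ≠ 0 := by
  let b := Module.finBasis K V
  let i : Fin (Module.finrank K V) := ⟨0, by omega⟩
  let j : Fin (Module.finrank K V) := ⟨1, by omega⟩
  have hij : i ≠ j := by simp [i, j]
  have hlin : LinearIndependent K ![b i, b j] := by
    have := b.linearIndependent.comp ![i, j] (by
      intro x y; fin_cases x <;> fin_cases y <;> simp [hij, hij.symm])
    convert this using 1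
    ext x; fin_cases x <;> rfl
  -- `π` is the projection along this plane onto a complement, and `f` the coordinate of `b i`.
  let S := Submodule.span K (Set.range ![b i, b j])
  obtain ⟨T, hT⟩ := Submodule.exists_isCompl S
  have hker : LinearMap.ker (T.projection S hT.symm) = S :=
    Submodule.ker_projection hT.symm
  refine ⟨b.coord i, T.projection S hT.symm, b i, b j, ?_, ?_, ?_, by simp, by simp [hij],
    b.ne_zero j⟩
  · rw [hker, finrank_span_eq_card hlin, Fintype.card_fin]
  · rw [← LinearMap.mem_ker, hker]
    exact Submodule.subset_span ⟨0, rfl⟩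
  · rw [← LinearMap.mem_ker, hker]
    exact Submodule.subset_span ⟨1, rfl⟩

theorem lemma4p2 (p : ℕ) (hp : p.Prime) (hp_odd : Odd p) (n : ℕ) (hn : 3 ≤ n) :
    ∃ (G : Type) (_ : Group G),
      IsUltraspecial p G ∧ Nat.card G = p ^ (3 * n) ∧
        ∃ A : Subgroup G, IsMaximalAbelian A ∧ Nat.card A = p ^ (n + 2) ∧
          commutator G ≤ A ∧ (commutator G).relIndex A = p ^ 2 := by
  have : Fact p.Prime := ⟨hp⟩
  let F := GaloisField p n
  have hF : Nat.card F = p ^ n := GaloisField.card p n (by omega)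
  obtain ⟨f, π, u, v, hfin, hπu, hπv, hfu, hfv, hv₀⟩ :=
    exists_endomorphism_ker_finrank_two (K := ZMod p) (V := F)
      (by rw [GaloisField.finrank p (by omega)]; omega)
  -- The alternation of `ψ` is `f x • π y - f y • π x`. Both `f` and `π` kill `v`, which is thus in
  -- its radical; pairing with `u` gives `π y`, so only `ker π` is orthogonal to `u`.
  let ψ : F →+ F →+ F :=
    AddMonoidHom.mk' (fun x => (f x • π).toAddMonoidHom) (fun x y => by
      ext z; simp [add_smul])
  have hψ (x y : F) : ψ x y = f x • π y := rfl
  let S : AddSubgroup F := (LinearMap.ker π).toAddSubgroup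
  have hS : Nat.card S = p ^ 2 := by
    have := Module.natCard_eq_pow_finrank (K := ZMod p) (V := LinearMap.ker π)
    rwa [hfin, Nat.card_zmod] at this
  have hA : Nat.card (TwistedHeisenberg.sndSubgroup ψ S) = p ^ (n + 2) := by
    rw [TwistedHeisenberg.card_sndSubgroup, hS, hF, ← pow_add, add_comm]
  have hle : commutator (TwistedHeisenberg ψ) ≤ TwistedHeisenberg.sndSubgroup ψ S := by
    rw [TwistedHeisenberg.commutator_eq_center]
    exact TwistedHeisenberg.center_le_sndSubgroup S
  refine ⟨TwistedHeisenberg ψ, inferInstance, TwistedHeisenberg.isUltraspecial (by omega) hF,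
    by rw [TwistedHeisenberg.card_eq, hF, ← pow_mul, mul_comm],
    TwistedHeisenberg.sndSubgroup ψ S, ?_, hA, hle, ?_⟩
  · refine TwistedHeisenberg.isMaximalAbelian_sndSubgroup (u := u) (v := v) ?_ hπu hπv hv₀ ?_ ?_
    · intro x hx y hy
      rw [hψ, hψ, show π x = 0 from hx, show π y = 0 from hy, smul_zero, smul_zero]
    · intro y
      rw [hψ, hψ, hfv, hπv, zero_smul, smul_zero]
    · intro y hy
      rw [hψ, hψ, hfu, hπu, one_smul, smul_zero] at hy
      exact hy
  · have H := Subgroup.card_mul_relIndex hle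
    rw [hA, TwistedHeisenberg.commutator_eq_center, TwistedHeisenberg.card_center, hF,
      pow_add] at H
    rw [TwistedHeisenberg.commutator_eq_center]
    exact Nat.eq_of_mul_eq_mul_left (pow_pos hp.pos n) H
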